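/- Let $F$ be Thompson's group: the group of all strictly increasing piecewise linear homeomorphisms of $[0,1]$ that are differentiable except at finitely many dyadic rational numbers and whose derivatives, where they exist, are integer powers of $2$. Let $x_0,x_1\in F$ be its standard generators $$x_0(t)=\begin{cases}\frac t2,&0\le t\le\frac12,\\ t-\frac14,&\frac12\le t\le\frac34,\\ 2t-1,&\frac34\le t\le1,\end{cases}\qquad x_1(t)=\begin{cases}t,&0\le t\le\frac12,\\ \frac t2+\frac14,&\frac12\le t\le\frac34,\\ t-\frac18,&\frac34\le t\le\frac78,\\ 2t-1,&\frac78\le t\le1.\end{cases}$$ For $x\in[0,1]$, the Schreier graph $\Gamma_x$ of the action of $F$ on the orbit of $x$ is the oriented labeled graph whose vertices are the points of the $F$-orbit of $x$, with an arrow labeled $s\in\{x_0,x_1\}$ from $y$ to $z$ if and only if $s(y)=z$. Then for every $x\in(0,1)$ the graph $\Gamma_x$ (regarded as an undirected graph) has infinitely many ends, where an end is a compatible choice, for each finite set $K$ of vertices, of a connected component of the complement of $K$. -/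

import Mathlib

open Topology

namespace Thompson

/-- Dyadic rational numbers, as real numbers. -/
def IsDyadic (r : ℝ) : Prop := ∃ (m : ℤ) (n : ℕ), r = (m : ℝ) / 2 ^ n

/-- `f` is a strictly increasing homeomorphism of `[0,1]`, and there is a finite set `B` of dyadic
rationals such that, around each point of `[0,1]` outside `B`, `f` is affine with slope an
integer power of `2`. Hence `f` is piecewise linear, it can fail to be differentiable only at the
points of `B`, and its derivatives are integer powers of `2`. -/
def IsThompson (f : unitInterval ≃ₜ unitInterval) : Prop :=
  StrictMono f ∧ ∃ B : Finset ℝ, (∀ b ∈ B, IsDyadic b) ∧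
    ∀ t : unitInterval, (t : ℝ) ∉ B →
      ∃ (k : ℤ) (c : ℝ), ∀ᶠ s : unitInterval in 𝓝 t, (f s : ℝ) = (2 : ℝ) ^ k * (s : ℝ) + c

lemma IsDyadic.add {a b : ℝ} (ha : IsDyadic a) (hb : IsDyadic b) : IsDyadic (a + b) := by
  obtain ⟨m, n, rfl⟩ := ha
  obtain ⟨p, q, rfl⟩ := hb
  refine ⟨m * 2 ^ q + p * 2 ^ n, n + q, ?_⟩
  push_cast
  field_simp
  ring

lemma IsDyadic.neg {a : ℝ} (ha : IsDyadic a) : IsDyadic (-a) := by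
  obtain ⟨m, n, rfl⟩ := ha
  exact ⟨-m, n, by push_cast; ring⟩

lemma IsDyadic.zpow_mul {a : ℝ} (ha : IsDyadic a) (k : ℤ) : IsDyadic ((2 : ℝ) ^ k * a) := by
  obtain ⟨m, n, rfl⟩ := ha
  obtain ⟨j, rfl | rfl⟩ := Int.eq_nat_or_neg k
  · exact ⟨2 ^ j * m, n, by push_cast; rw [zpow_natCast]; ring⟩
  · refine ⟨m, j + n, ?_⟩
    rw [zpow_neg, zpow_natCast, pow_add]
    field_simp

lemma affine_on_Ioo {f : unitInterval ≃ₜ unitInterval} {B : Finset ℝ}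
    (hB : ∀ t : unitInterval, (t : ℝ) ∉ B →
      ∃ (k : ℤ) (c : ℝ), ∀ᶠ s : unitInterval in 𝓝 t, (f s : ℝ) = (2 : ℝ) ^ k * (s : ℝ) + c)
    {a t : unitInterval} (hat : a < t) (h : ∀ s ∈ Set.Ioo a t, (s : ℝ) ∉ B) :
    ∃ k : ℤ, (f t : ℝ) = (f a : ℝ) + (2 : ℝ) ^ k * ((t : ℝ) - (a : ℝ)) := by
  obtain ⟨m, hm⟩ := exists_between hat
  obtain ⟨k, c, hkc⟩ := hB m (h m hm)
  set u : Set unitInterval :=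
    {s | ∀ᶠ r : unitInterval in 𝓝 s, (f r : ℝ) = (2 : ℝ) ^ k * (r : ℝ) + c} with hu
  have hsub : Set.Ioo a t ⊆ u := by
    refine isPreconnected_Ioo.subset_of_closure_inter_subset
      isOpen_setOfPred_eventually_nhds ⟨m, hm, hkc⟩ ?_
    rintro s ⟨hs, hsI⟩
    obtain ⟨k', c', hk'⟩ := hB s (h s hsI)
    obtain ⟨s', hs'u, hs'⟩ :=
      ((mem_closure_iff_frequently.1 hs).and_eventually hk'.eventually_nhds).exists
    have hb : ∀ᶠ r : unitInterval in 𝓝 s',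
        (2 : ℝ) ^ k * (r : ℝ) + c = (2 : ℝ) ^ k' * (r : ℝ) + c' := by
      filter_upwards [hs'u, hs'] with r h1 h2
      rw [← h1, h2]
    obtain ⟨r, hr, hne⟩ := ((hb.filter_mono nhdsWithin_le_nhds).and
      (self_mem_nhdsWithin : {s'}ᶜ ∈ 𝓝[≠] s')).exists
    have h0 := hb.self_of_nhds
    have hne' : (r : ℝ) - (s' : ℝ) ≠ 0 := by
      intro h3
      exact hne (Subtype.ext (by linarith))
    have hk : (2 : ℝ) ^ k = (2 : ℝ) ^ k' := by
      apply mul_right_cancel₀ hne'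
      linarith
    have hc : c = c' := by
      rw [hk] at h0
      linarith
    change ∀ᶠ r : unitInterval in 𝓝 s, (f r : ℝ) = (2 : ℝ) ^ k * (r : ℝ) + c
    rw [hk, hc]
    exact hk'
  have hcl : Set.Icc a t ⊆ {s : unitInterval | (f s : ℝ) = (2 : ℝ) ^ k * (s : ℝ) + c} := by
    rw [← closure_Ioo hat.ne]
    refine closure_minimal (fun s hs => (hsub hs).self_of_nhds) (isClosed_eq ?_ ?_)
    · exact continuous_subtype_val.comp f.continuous
    · fun_prop
  have h1 : (f a : ℝ) = (2 : ℝ) ^ k * (a : ℝ) + c := hcl (Set.left_mem_Icc.2 hat.le)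
  have h2 : (f t : ℝ) = (2 : ℝ) ^ k * (t : ℝ) + c := hcl (Set.right_mem_Icc.2 hat.le)
  exact ⟨k, by rw [h1, h2]; ring⟩

lemma map_zero_of_strictMono {f : unitInterval ≃ₜ unitInterval} (hf : StrictMono f) :
    f 0 = 0 := by
  refine le_antisymm ?_ (show (0 : unitInterval) ≤ f 0 from (f 0).2.1)
  calc f 0 ≤ f (f.symm 0) := hf.monotone (f.symm 0).2.1
    _ = 0 := f.apply_symm_apply 0

lemma IsThompson.isDyadic_apply {f : unitInterval ≃ₜ unitInterval} (hf : IsThompson f)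
    (t : unitInterval) (ht : IsDyadic t) : IsDyadic (f t) := by
  obtain ⟨hmono, B, hBd, hB⟩ := hf
  obtain ⟨N, hN⟩ : ∃ N, (B.filter (fun b => b < (t : ℝ))).card = N := ⟨_, rfl⟩
  induction N using Nat.strong_induction_on generalizing t with
  | _ N ih =>
    have main : ∀ a : unitInterval, IsDyadic (f a) → IsDyadic a → a < t →
        (∀ s ∈ Set.Ioo a t, (s : ℝ) ∉ B) → IsDyadic (f t) := by
      intro a hfa ha hat h
      obtain ⟨k, hk⟩ := affine_on_Ioo hB hat h
      rw [hk]
      exact hfa.add ((ht.add ha.neg).zpow_mul k)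
    have hf0 : IsDyadic (f 0) := by
      rw [map_zero_of_strictMono hmono]
      exact ⟨0, 0, by simp⟩
    have h0 : IsDyadic ((0 : unitInterval) : ℝ) := ⟨0, 0, by simp⟩
    by_cases hex : ∃ b ∈ B, 0 < b ∧ b < (t : ℝ)
    · have hne : (B.filter (fun b => 0 < b ∧ b < (t : ℝ))).Nonempty := by
        obtain ⟨b, hb, h⟩ := hex
        exact ⟨b, by simp [hb, h]⟩
      obtain ⟨b, hb, hmax⟩ := Finset.exists_max_image _ id hne
      obtain ⟨hbB, hb0, hbt⟩ := Finset.mem_filter.1 hb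
      let a : unitInterval := ⟨b, hb0.le, hbt.le.trans t.2.2⟩
      refine main a (ih _ ?_ a (hBd b hbB) rfl) (hBd b hbB) hbt ?_
      · rw [← hN]
        apply Finset.card_lt_card
        refine ⟨?_, ?_⟩
        · intro z hz
          simp only [Finset.mem_filter] at hz ⊢
          exact ⟨hz.1, hz.2.trans hbt⟩
        · intro hss
          have : b ∈ B.filter (fun z => z < (a : ℝ)) := hss (by simp [hbB, hbt])
          simp [a] at this
      · intro s hs hsB
        have h1 : b < (s : ℝ) := hs.1
        have h2 : (s : ℝ) < t := hs.2
        have := hmax s (by simp only [Finset.mem_filter]; exact ⟨hsB, hb0.trans h1, h2⟩)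
        simp only [id] at this
        linarith
    · rcases eq_or_lt_of_le t.2.1 with h | h
      · have : t = 0 := Subtype.ext h.symm
        rw [this]
        exact hf0
      · refine main 0 hf0 h0 h ?_
        intro s hs hsB
        exact hex ⟨s, hsB, hs.1, hs.2⟩

lemma IsThompson.inv {f : unitInterval ≃ₜ unitInterval} (hf : IsThompson f) :
    IsThompson f⁻¹ := by
  have hdy := hf.isDyadic_apply
  obtain ⟨hmono, B, hBd, hB⟩ := hf
  classical
  refine ⟨?_, (B.subtype (· ∈ unitInterval)).image (fun b => (f b : ℝ)), ?_, ?_⟩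
  · intro a b hab
    change f.symm a < f.symm b
    rw [← hmono.lt_iff_lt]
    simpa using hab
  · intro b hb
    obtain ⟨z, hz, rfl⟩ := Finset.mem_image.1 hb
    exact hdy z (hBd _ (by simpa using hz))
  · intro t ht
    have h1 : ((f.symm t : unitInterval) : ℝ) ∉ B := by
      intro h
      apply ht
      exact Finset.mem_image.2 ⟨f.symm t, Finset.mem_subtype.2 h, by simp⟩
    obtain ⟨k, c, hkc⟩ := hB _ h1
    refine ⟨-k, -((2 : ℝ) ^ (-k) * c), ?_⟩
    filter_upwards [f.symm.continuous.continuousAt.eventually hkc] with s hs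
    change ((f.symm s : unitInterval) : ℝ) = _
    rw [f.apply_symm_apply] at hs
    rw [hs, zpow_neg]
    field_simp
    ring

lemma IsThompson.mul {f g : unitInterval ≃ₜ unitInterval} (hf : IsThompson f)
    (hg : IsThompson g) : IsThompson (f * g) := by
  have hdy := hg.inv.isDyadic_apply
  obtain ⟨hfm, B, hBd, hB⟩ := hf
  obtain ⟨hgm, C, hCd, hC⟩ := hg
  classical
  refine ⟨hfm.comp hgm,
    C ∪ (B.subtype (· ∈ unitInterval)).image (fun b => (g.symm b : ℝ)), ?_, ?_⟩
  · intro b hb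
    rcases Finset.mem_union.1 hb with hb | hb
    · exact hCd b hb
    · obtain ⟨z, hz, rfl⟩ := Finset.mem_image.1 hb
      exact hdy z (hBd _ (by simpa using hz))
  · intro t ht
    rw [Finset.mem_union, not_or] at ht
    obtain ⟨ht1, ht2⟩ := ht
    have h1 : ((g t : unitInterval) : ℝ) ∉ B := by
      intro h
      apply ht2
      exact Finset.mem_image.2 ⟨g t, Finset.mem_subtype.2 h, by simp⟩
    obtain ⟨k, c, hkc⟩ := hB _ h1
    obtain ⟨l, d, hld⟩ := hC t ht1
    refine ⟨k + l, (2 : ℝ) ^ k * d + c, ?_⟩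
    filter_upwards [g.continuous.continuousAt.eventually hkc, hld] with s hs1 hs2
    change ((f (g s) : unitInterval) : ℝ) = _
    rw [hs1, hs2, zpow_add₀ two_ne_zero]
    ring

lemma IsThompson.one : IsThompson 1 := by
  refine ⟨strictMono_id, ∅, by simp, fun t _ => ⟨0, 0, Filter.Eventually.of_forall fun s => ?_⟩⟩
  change (s : ℝ) = _
  simp

end Thompson

/-- Thompson's group `F`, as a group of homeomorphisms of `[0,1]` under composition. -/
def ThompsonF : Subgroup (unitInterval ≃ₜ unitInterval) where
  carrier := {f | Thompson.IsThompson f}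
  mul_mem' := Thompson.IsThompson.mul
  one_mem' := Thompson.IsThompson.one
  inv_mem' := Thompson.IsThompson.inv

namespace ThompsonF

/-- The action of `F` on `[0,1]` by evaluation. -/
instance : MulAction ThompsonF unitInterval where
  smul f t := (f : unitInterval ≃ₜ unitInterval) t
  one_smul _ := rfl
  mul_smul _ _ _ := rfl

noncomputable section

/-- The map `x₀` on `[0,1]`. -/
def x0Fun (t : unitInterval) : unitInterval :=
  ⟨if (t : ℝ) ≤ 1 / 2 then t / 2 else if (t : ℝ) ≤ 3 / 4 then t - 1 / 4 else 2 * t - 1, by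
    have h0 := t.2.1
    have h1 := t.2.2
    split_ifs <;> constructor <;> linarith⟩

/-- The inverse of `x₀`. -/
def x0Inv (t : unitInterval) : unitInterval :=
  ⟨if (t : ℝ) ≤ 1 / 4 then 2 * t else if (t : ℝ) ≤ 1 / 2 then t + 1 / 4 else (t + 1) / 2, by
    have h0 := t.2.1
    have h1 := t.2.2
    split_ifs <;> constructor <;> linarith⟩

/-- The map `x₁` on `[0,1]`. -/
def x1Fun (t : unitInterval) : unitInterval :=
  ⟨if (t : ℝ) ≤ 1 / 2 then t else if (t : ℝ) ≤ 3 / 4 then t / 2 + 1 / 4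
    else if (t : ℝ) ≤ 7 / 8 then t - 1 / 8 else 2 * t - 1, by
    have h0 := t.2.1
    have h1 := t.2.2
    split_ifs <;> constructor <;> linarith⟩

/-- The inverse of `x₁`. -/
def x1Inv (t : unitInterval) : unitInterval :=
  ⟨if (t : ℝ) ≤ 1 / 2 then t else if (t : ℝ) ≤ 5 / 8 then 2 * t - 1 / 2
    else if (t : ℝ) ≤ 3 / 4 then t + 1 / 8 else (t + 1) / 2, by
    have h0 := t.2.1
    have h1 := t.2.2
    split_ifs <;> constructor <;> linarith⟩

lemma x0Fun_strictMono : StrictMono x0Fun := by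
  intro a b hab
  have hab' : (a : ℝ) < b := hab
  rw [← Subtype.coe_lt_coe]
  simp only [x0Fun]
  split_ifs <;> linarith

lemma x0Fun_rightInverse : Function.RightInverse x0Inv x0Fun := by
  intro t
  apply Subtype.ext
  simp only [x0Fun, x0Inv]
  split_ifs <;> linarith

lemma x1Fun_strictMono : StrictMono x1Fun := by
  intro a b hab
  have hab' : (a : ℝ) < b := hab
  rw [← Subtype.coe_lt_coe]
  simp only [x1Fun]
  split_ifs <;> linarith

lemma x1Fun_rightInverse : Function.RightInverse x1Inv x1Fun := by
  intro t
  apply Subtype.ext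
  simp only [x1Fun, x1Inv]
  split_ifs <;> linarith

/-- `x₀` as a homeomorphism of `[0,1]`. -/
def x0Homeo : unitInterval ≃ₜ unitInterval :=
  (x0Fun_strictMono.orderIsoOfRightInverse x0Fun x0Inv x0Fun_rightInverse).toHomeomorph

/-- `x₁` as a homeomorphism of `[0,1]`. -/
def x1Homeo : unitInterval ≃ₜ unitInterval :=
  (x1Fun_strictMono.orderIsoOfRightInverse x1Fun x1Inv x1Fun_rightInverse).toHomeomorph

lemma eventually_lt_coe {t : unitInterval} {r : ℝ} (h : r < (t : ℝ)) :
    ∀ᶠ s : unitInterval in 𝓝 t, r < (s : ℝ) :=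
  continuous_subtype_val.continuousAt.eventually (lt_mem_nhds h)

lemma eventually_coe_lt {t : unitInterval} {r : ℝ} (h : (t : ℝ) < r) :
    ∀ᶠ s : unitInterval in 𝓝 t, (s : ℝ) < r :=
  continuous_subtype_val.continuousAt.eventually (gt_mem_nhds h)

lemma x0Homeo_mem : x0Homeo ∈ ThompsonF := by
  refine ⟨x0Fun_strictMono, {1 / 2, 3 / 4}, ?_, ?_⟩
  · intro b hb
    simp only [Finset.mem_insert, Finset.mem_singleton] at hb
    rcases hb with rfl | rfl
    · exact ⟨1, 1, by norm_num⟩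
    · exact ⟨3, 2, by norm_num⟩
  · intro t ht
    simp only [Finset.mem_insert, Finset.mem_singleton, not_or] at ht
    obtain ⟨h1, h2⟩ := ht
    change ∃ (k : ℤ) (c : ℝ), ∀ᶠ s : unitInterval in 𝓝 t,
      ((x0Fun s : unitInterval) : ℝ) = (2 : ℝ) ^ k * (s : ℝ) + c
    rcases lt_or_gt_of_ne h1 with h1 | h1
    · refine ⟨-1, 0, ?_⟩
      filter_upwards [eventually_coe_lt h1] with s hs
      simp only [x0Fun, zpow_neg_one]
      split_ifs <;> linarith
    · rcases lt_or_gt_of_ne h2 with h2 | h2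
      · refine ⟨0, -(1 / 4), ?_⟩
        filter_upwards [eventually_lt_coe h1, eventually_coe_lt h2] with s hs hs'
        simp only [x0Fun, zpow_zero]
        split_ifs <;> linarith
      · refine ⟨1, -1, ?_⟩
        filter_upwards [eventually_lt_coe h2] with s hs
        simp only [x0Fun, zpow_one]
        split_ifs <;> linarith

lemma x1Homeo_mem : x1Homeo ∈ ThompsonF := by
  refine ⟨x1Fun_strictMono, {1 / 2, 3 / 4, 7 / 8}, ?_, ?_⟩
  · intro b hb
    simp only [Finset.mem_insert, Finset.mem_singleton] at hb
    rcases hb with rfl | rfl | rfl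
    · exact ⟨1, 1, by norm_num⟩
    · exact ⟨3, 2, by norm_num⟩
    · exact ⟨7, 3, by norm_num⟩
  · intro t ht
    simp only [Finset.mem_insert, Finset.mem_singleton, not_or] at ht
    obtain ⟨h1, h2, h3⟩ := ht
    change ∃ (k : ℤ) (c : ℝ), ∀ᶠ s : unitInterval in 𝓝 t,
      ((x1Fun s : unitInterval) : ℝ) = (2 : ℝ) ^ k * (s : ℝ) + c
    rcases lt_or_gt_of_ne h1 with h1 | h1
    · refine ⟨0, 0, ?_⟩
      filter_upwards [eventually_coe_lt h1] with s hs
      simp only [x1Fun, zpow_zero]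
      split_ifs <;> linarith
    · rcases lt_or_gt_of_ne h2 with h2 | h2
      · refine ⟨-1, 1 / 4, ?_⟩
        filter_upwards [eventually_lt_coe h1, eventually_coe_lt h2] with s hs hs'
        simp only [x1Fun, zpow_neg_one]
        split_ifs <;> linarith
      · rcases lt_or_gt_of_ne h3 with h3 | h3
        · refine ⟨0, -(1 / 8), ?_⟩
          filter_upwards [eventually_lt_coe h2, eventually_coe_lt h3] with s hs hs'
          simp only [x1Fun, zpow_zero]
          split_ifs <;> linarith
        · refine ⟨1, -1, ?_⟩
          filter_upwards [eventually_lt_coe h3] with s hs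
          simp only [x1Fun, zpow_one]
          split_ifs <;> linarith

/-- The standard generators `x₀, x₁` of `F`, which label the edges of the Schreier graph. -/
def gen : Fin 2 → ThompsonF :=
  ![⟨x0Homeo, x0Homeo_mem⟩, ⟨x1Homeo, x1Homeo_mem⟩]

end

/-- The Schreier graph of `x`: the vertices are the points of the `F`-orbit of `x`, and for each
generator `s` there is an arrow labelled `s` from each vertex `y` to `s(y)`. -/
abbrev SchreierGraphOf (x : unitInterval) : Type :=
  Quiver.SchreierGraph (MulAction.orbit ThompsonF x) gen

/-- The undirected graph underlying the Schreier graph of `x` (labels, directions, loops and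
multiplicities of edges, which do not affect the ends, are forgotten). -/
def underlyingGraph (x : unitInterval) : SimpleGraph (SchreierGraphOf x) :=
  SimpleGraph.fromRel fun a b => Nonempty (a ⟶ b)

end ThompsonF

/-! On `[0, 1/2]` the generator `x₀` halves and `x₁` is the identity, so below a vertex `y` of
`(1/4, 1/2]` the graph is the bare ray `y, y/2, y/4, …`, joined to the rest only at `y`. Deleting
`y` cuts this ray off from every other such ray, hence distinct `y` give distinct ends
(`halving_tail_closed`, `infinite_end_of_infinite_vertices`). Infinitely many such `y` exist. Powers
of `x₀` bring an interior point to some `z` in `(1/2, 3/4]` (`exists_position_mem`), iterating `x₁`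
contracts `z` towards `1/2` through distinct points, and one more `x₀` shifts these into `(1/4,
1/2]`. -/

namespace SimpleGraph

/-! ### Ends and components in a general graph. -/

variable {V : Type*} (G : SimpleGraph V)

/-- An injective ray determines an end, whose component outside of `K` contains every vertex
of the ray from which on the ray avoids `K`. -/
theorem exists_end_of_ray (r : ℕ → V) (hr : Function.Injective r)
    (hadj : ∀ n, G.Adj (r n) (r (n + 1))) :
    ∃ e ∈ G.end, ∀ (K : (Finset V)ᵒᵖ) (n : ℕ) (h : ∀ m, n ≤ m → r m ∉ (K.unop : Set V)),
      e K = G.componentComplMk (h n le_rfl) := by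
  have hex : ∀ K : (Finset V)ᵒᵖ, ∃ n, ∀ m, n ≤ m → r m ∉ (K.unop : Set V) := by
    intro K
    obtain ⟨n, hn⟩ := (K.unop.finite_toSet.preimage hr.injOn).bddAbove
    exact ⟨n + 1, fun m hm hK => by
      have := hn hK
      omega⟩
  choose N hN using hex
  have key : ∀ (K : Set V) (n : ℕ) (h : ∀ m, n ≤ m → r m ∉ K) (k : ℕ) (hk : n ≤ k),
      G.componentComplMk (h k hk) = G.componentComplMk (h n le_rfl) := by
    intro K n h k hk
    induction k, hk using Nat.le_induction with
    | base => rfl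
    | succ k hk ih =>
      rw [← ih]
      exact (G.componentComplMk_eq_of_adj _ _ (hadj k)).symm
  have key' : ∀ (K : Set V) (n n' : ℕ) (h : ∀ m, n ≤ m → r m ∉ K) (h' : ∀ m, n' ≤ m → r m ∉ K),
      G.componentComplMk (h n le_rfl) = G.componentComplMk (h' n' le_rfl) := fun K n n' h h' =>
    (key K n h (max n n') (le_max_left _ _)).symm.trans (key K n' h' _ (le_max_right _ _))
  refine ⟨fun K => G.componentComplMk (hN K _ le_rfl), ?_, fun K n h => key' _ _ _ (hN K) h⟩
  -- Compatibility: beyond the index chosen for the larger set `K`, the ray also avoids `L ⊆ K`.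
  intro K L f
  have hLK : (L.unop : Set V) ⊆ K.unop := CategoryTheory.le_of_op_hom f
  exact key' _ _ _ (fun m hm hmL => hN K m hm (hLK hmL)) (hN L)

/-- A set of vertices closed under passing to neighbours outside of `K` contains, with a vertex
outside of `K`, all vertices of its component. -/
theorem mem_of_componentComplMk_eq {K S : Set V}
    (hS : ∀ a b, a ∈ S → b ∉ K → G.Adj a b → b ∈ S) {v w : V} (hv : v ∉ K) (hw : w ∉ K)
    (h : G.componentComplMk hv = G.componentComplMk hw) (hvS : v ∈ S) : w ∈ S := by
  -- Membership in `S` is constant along edges outside `K`, so it descends to a `Prop`-valued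
  -- function on components.
  have := congrArg (ComponentCompl.lift (fun u (_ : u ∉ K) => u ∈ S) fun a b ha hb hab =>
    propext ⟨fun haS => hS a b haS hb hab, fun hbS => hS b a hbS ha hab.symm⟩) h
  exact this.mp hvS

end SimpleGraph

/-! ### The Schreier graph in real coordinates. -/

namespace ThompsonF

variable {x : unitInterval}

/-- The position in `[0,1]` of a vertex of the Schreier graph. -/
def position (v : SchreierGraphOf x) : ℝ := ((v.toVertex : unitInterval) : ℝ)

lemma position_injective : Function.Injective (position (x := x)) := by
  rintro ⟨a⟩ ⟨b⟩ h
  exact congrArg _ (Subtype.ext (Subtype.ext h))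

lemma position_x0_smul (v : SchreierGraphOf x) : position (gen 0 • v) =
    if position v ≤ 1 / 2 then position v / 2
    else if position v ≤ 3 / 4 then position v - 1 / 4 else 2 * position v - 1 := rfl

lemma position_x1_smul (v : SchreierGraphOf x) : position (gen 1 • v) =
    if position v ≤ 1 / 2 then position v else if position v ≤ 3 / 4 then position v / 2 + 1 / 4
    else if position v ≤ 7 / 8 then position v - 1 / 8 else 2 * position v - 1 := rfl

/-- Definitional, because `x0Homeo` is built with `x0Inv` as its inverse. -/
lemma position_x0_inv_smul (v : SchreierGraphOf x) : position ((gen 0)⁻¹ • v) =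
    if position v ≤ 1 / 4 then 2 * position v
    else if position v ≤ 1 / 2 then position v + 1 / 4 else (position v + 1) / 2 := rfl

lemma underlyingGraph_adj {a b : SchreierGraphOf x} : (underlyingGraph x).Adj a b ↔
    a ≠ b ∧ ((∃ s, gen s • a = b) ∨ ∃ s, gen s • b = a) := by
  rw [underlyingGraph, SimpleGraph.fromRel_adj]
  exact and_congr_right fun _ => or_congr nonempty_subtype nonempty_subtype

lemma position_x0_pow_smul {y : SchreierGraphOf x} (h0 : 0 ≤ position y)
    (h : position y ≤ 1 / 2) (n : ℕ) : position (gen 0 ^ n • y) = position y / 2 ^ n := by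
  induction n with
  | zero => simp
  | succ n ih =>
    have : position y / 2 ^ n ≤ position y := div_le_self h0 (one_le_pow₀ one_le_two)
    rw [pow_succ', mul_smul, position_x0_smul, ih, if_pos (this.trans h), pow_succ, div_div]

lemma position_x1_pow_smul {z : SchreierGraphOf x} (h : 1 / 2 < position z)
    (h' : position z ≤ 3 / 4) (n : ℕ) :
    position (gen 1 ^ n • z) = 1 / 2 + (position z - 1 / 2) / 2 ^ n := by
  induction n with
  | zero => simp
  | succ n ih =>
    have h1 : (position z - 1 / 2) / 2 ^ n ≤ position z - 1 / 2 :=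
      div_le_self (by linarith) (one_le_pow₀ one_le_two)
    have h2 : 0 < (position z - 1 / 2) / 2 ^ n := div_pos (by linarith) (by positivity)
    rw [pow_succ', mul_smul, position_x1_smul, ih, if_neg (by linarith), if_pos (by linarith),
      pow_succ, ← div_div]
    ring

/-! ### Halving rays and the ends they define. -/

/-- The set of points `y / 2 ^ n`, `n ≥ 1`, is only connected to its complement through `y`. -/
lemma halving_tail_closed {y : SchreierGraphOf x} (h0 : 0 < position y)
    (h : position y ≤ 1 / 2) {a b : SchreierGraphOf x}
    (ha : ∃ n : ℕ, position a = position y / 2 ^ (n + 1)) (hb : b ≠ y)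
    (hab : (underlyingGraph x).Adj a b) : ∃ n : ℕ, position b = position y / 2 ^ (n + 1) := by
  obtain ⟨n, hn⟩ := ha
  have hle : position a ≤ 1 / 4 := by
    have : position y / 2 ^ n ≤ position y := div_le_self h0.le (one_le_pow₀ one_le_two)
    rw [hn, pow_succ, ← div_div]
    linarith
  obtain ⟨hne, ⟨s, rfl⟩ | ⟨s, rfl⟩⟩ := underlyingGraph_adj.1 hab
  · fin_cases s
    · refine ⟨n + 1, (position_x0_smul a).trans ?_⟩
      rw [if_pos (by linarith), hn, pow_succ _ (n + 1), div_div]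
    · refine absurd (position_injective ?_) hne
      exact ((position_x1_smul a).trans (if_pos (by linarith))).symm
  · fin_cases s
    · have hs := position_x0_smul b
      change position (gen 0 • b) ≤ _ at hle
      change position (gen 0 • b) = _ at hn
      -- The other two branches of `x₀` only take values above `1/4`, so `b` is the double of `a`;
      -- for `n = 0` this is the excluded vertex `y`.
      have hb2 : position b = position y / 2 ^ n := by
        rw [pow_succ, ← div_div] at hn
        split_ifs at hs <;> linarith
      cases n with
      | zero => exact absurd (position_injective (by simpa using hb2)) hb
      | succ n => exact ⟨n, hb2⟩
    · have hs := position_x1_smul b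
      change position (gen 1 • b) ≤ _ at hle
      refine absurd (position_injective ?_) hne
      change position (gen 1 • b) = _
      split_ifs at hs <;> linarith

/-- The ray `y, y / 2, y / 4, …` of a vertex in `(1/4, 1/2]` determines an end. -/
lemma exists_end_of_halving {y : SchreierGraphOf x} (h : 1 / 4 < position y)
    (h' : position y ≤ 1 / 2) : ∃ e ∈ (underlyingGraph x).end,
      ∀ (K : (Finset (SchreierGraphOf x))ᵒᵖ) (n : ℕ)
        (h : ∀ m, n ≤ m → gen 0 ^ m • y ∉ (K.unop : Set (SchreierGraphOf x))),
        e K = (underlyingGraph x).componentComplMk (h n le_rfl) := by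
  have hinj : Function.Injective fun n : ℕ => gen 0 ^ n • y := by
    intro m n hmn
    have := congrArg position hmn
    simp only [position_x0_pow_smul (by linarith) h'] at this
    have hy0 : position y ≠ 0 := by linarith
    rw [div_eq_div_iff (by positivity) (by positivity), mul_right_inj' hy0] at this
    exact (pow_right_injective₀ two_pos (by norm_num) this).symm
  exact (underlyingGraph x).exists_end_of_ray _ hinj fun n =>
    underlyingGraph_adj.2 ⟨fun h => n.succ_ne_self (hinj h).symm, Or.inl ⟨0, by
      rw [pow_succ', mul_smul]⟩⟩

/-- Infinitely many vertices in `(1/4, 1/2]` give infinitely many ends. -/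
lemma infinite_end_of_infinite_vertices (f : ℕ → SchreierGraphOf x) (hf : Function.Injective f)
    (h : ∀ n, 1 / 4 < position (f n)) (h' : ∀ n, position (f n) ≤ 1 / 2) :
    (underlyingGraph x).end.Infinite := by
  choose e he heK using fun n => exists_end_of_halving (h n) (h' n)
  refine Set.infinite_of_injective_forall_mem (f := e) (fun i j hij => hf ?_) he
  by_contra hne
  have hle : ∀ k m : ℕ, position (gen 0 ^ (m + 1) • f k) ≤ 1 / 4 := fun k m => by
    have h0 : 0 ≤ position (f k) := by linarith [h k]
    have : position (f k) / 2 ^ m ≤ position (f k) := div_le_self h0 (one_le_pow₀ one_le_two)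
    rw [position_x0_pow_smul h0 (h' k), pow_succ, ← div_div]
    linarith [h' k]
  -- With `K = {f i}`, the ray of `f i` avoids `K` only from index `1` on, the ray of `f j` from
  -- index `0`.
  have hi : ∀ m, 1 ≤ m → gen 0 ^ m • f i ∉
      ((Opposite.op {f i} : (Finset (SchreierGraphOf x))ᵒᵖ).unop : Set (SchreierGraphOf x)) := by
    rintro (_ | m) hm hmem
    · omega
    · have := hle i m
      rw [show gen 0 ^ (m + 1) • f i = f i by simpa using hmem] at this
      linarith [h i]
  have hj : ∀ m, 0 ≤ m → gen 0 ^ m • f j ∉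
      ((Opposite.op {f i} : (Finset (SchreierGraphOf x))ᵒᵖ).unop : Set (SchreierGraphOf x)) := by
    rintro (_ | m) - hmem
    · exact hne (by simpa using hmem : f j = f i).symm
    · have := hle j m
      rw [show gen 0 ^ (m + 1) • f j = f i by simpa using hmem] at this
      linarith [h i]
  -- Equal ends would put `f i / 2` and `f j` in one component, so `f j` would lie in the tail below
  -- `f i`, hence at most at `1/4`.
  have heq := (heK i _ 1 hi).symm.trans ((congrFun hij _).trans (heK j _ 0 hj))
  obtain ⟨n, hn⟩ := (underlyingGraph x).mem_of_componentComplMk_eq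
    (S := {a | ∃ n : ℕ, position a = position (f i) / 2 ^ (n + 1)})
    (fun a b ha hb hab => halving_tail_closed (by linarith [h i]) (h' i) ha
      (by simpa using hb) hab) _ _ heq
    ⟨0, position_x0_pow_smul (by linarith [h i]) (h' i) 1⟩
  have h1 := hle i n
  rw [position_x0_pow_smul (by linarith [h i]) (h' i), ← hn, pow_zero, one_smul] at h1
  linarith [h j]

/-! ### Finding infinitely many vertices in `(1/4, 1/2]`. -/

/-- Above `3/4`, `x₀` doubles the distance to `1` and stays above `1/2`; `n` bounds the number of
doublings needed. -/
lemma exists_position_mem_of_lt {v : SchreierGraphOf x} (h : 1 / 2 < position v)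
    (h' : position v < 1) : ∃ z : SchreierGraphOf x, 1 / 2 < position z ∧ position z ≤ 3 / 4 := by
  obtain ⟨n, hn⟩ := pow_unbounded_of_one_lt (1 / 4 / (1 - position v)) (one_lt_two (α := ℝ))
  rw [div_lt_iff₀ (by linarith)] at hn
  induction n generalizing v with
  | zero => exact ⟨v, h, by linarith⟩
  | succ n ih =>
    by_cases hv : position v ≤ 3 / 4
    · exact ⟨v, h, hv⟩
    · have hs := position_x0_smul v
      rw [if_neg (by linarith), if_neg hv] at hs
      refine ih (v := gen 0 • v) (by linarith) (by linarith) ?_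
      rw [hs]
      rw [pow_succ] at hn
      linarith

/-- `x₀⁻¹` doubles points up to `1/4` and shifts `(1/4, 1/2]` onto `(1/2, 3/4]`. -/
lemma exists_position_mem {v : SchreierGraphOf x} (h : 0 < position v)
    (h' : position v < 1) : ∃ z : SchreierGraphOf x, 1 / 2 < position z ∧ position z ≤ 3 / 4 := by
  obtain ⟨n, hn⟩ := pow_unbounded_of_one_lt (1 / 2 / position v) (one_lt_two (α := ℝ))
  rw [div_lt_iff₀ h] at hn
  induction n generalizing v with
  | zero => exact exists_position_mem_of_lt (by linarith) h'
  | succ n ih =>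
    rcases lt_or_ge (1 / 2) (position v) with hv | hv
    · exact exists_position_mem_of_lt hv h'
    · have hs := position_x0_inv_smul v
      by_cases hv4 : position v ≤ 1 / 4
      · rw [if_pos hv4] at hs
        refine ih (v := (gen 0)⁻¹ • v) (by linarith) (by linarith) ?_
        rw [hs]
        rw [pow_succ] at hn
        linarith
      · rw [if_neg hv4, if_pos hv] at hs
        exact ⟨_, by rw [hs]; linarith, by rw [hs]; linarith⟩

/-- The Schreier graph of an interior point has infinitely many ends. -/
theorem infinite_end_underlyingGraph (x : unitInterval) (hx : 0 < x ∧ x < 1) :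
    (underlyingGraph x).end.Infinite := by
  obtain ⟨z, hz, hz'⟩ := exists_position_mem
    (v := (⟨⟨x, MulAction.mem_orbit_self x⟩⟩ : SchreierGraphOf x)) hx.1 hx.2
  have hz0 : (0 : ℝ) < position z - 1 / 2 := by linarith
  have hpos : ∀ n : ℕ, position (gen 0 • gen 1 ^ n • z) =
      1 / 4 + (position z - 1 / 2) / 2 ^ n := by
    intro n
    have h1 : (position z - 1 / 2) / 2 ^ n ≤ position z - 1 / 2 :=
      div_le_self hz0.le (one_le_pow₀ one_le_two)
    have h2 : 0 < (position z - 1 / 2) / 2 ^ n := by positivity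
    rw [position_x0_smul, position_x1_pow_smul hz hz', if_neg (by linarith),
      if_pos (by linarith)]
    ring
  -- On `(1/2, 3/4]`, `x₀` is translation by `-1/4`, so the points accumulating at `1/2` from above
  -- become points of `(1/4, 1/2]`.
  refine infinite_end_of_infinite_vertices (fun n => gen 0 • gen 1 ^ n • z) ?_ ?_ ?_
  · intro m n hmn
    have := congrArg position hmn
    simp only [hpos, add_right_inj] at this
    rw [div_eq_div_iff (by positivity) (by positivity), mul_right_inj' hz0.ne'] at this
    exact (pow_right_injective₀ two_pos (by norm_num) this).symm
  · intro n
    rw [hpos]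
    linarith [show 0 < (position z - 1 / 2) / 2 ^ n by positivity]
  · intro n
    rw [hpos]
    linarith [show (position z - 1 / 2) / 2 ^ n ≤ position z - 1 / 2 from
      div_le_self hz0.le (one_le_pow₀ one_le_two)]

end ThompsonF

theorem mainTheorem12 (x : unitInterval) (hx : 0 < x ∧ x < 1) :
    (ThompsonF.underlyingGraph x).end.Infinite :=
  ThompsonF.infinite_end_underlyingGraph x hx
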